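/- Let $E\subseteq\mathbb{R}^n$ be an arbitrary subset and let $f:E\to\mathbb{R}$, $G:E\to\mathbb{R}^n$ be functions. Let $Y:=\operatorname{span}\{G(x)-G(y) : x,y\in E\}$ and let $P_Y:\mathbb{R}^n\to\mathbb{R}^n$ be the orthogonal projection onto $Y$. Assume that: (i) $G$ is continuous on $E$ and $f(x)\ge f(y)+\langle G(y),x-y\rangle$ for all $x,y\in E$. (ii) If $(x_k)_k$ is a sequence in $E$ with $\lim_{k\to\infty}|G(x_k)|=+\infty$, then $$\lim_{k\to\infty}\frac{\langle G(x_k),x_k\rangle-f(x_k)}{|G(x_k)|}=+\infty.$$ (iii) If $(x_k)_k,(z_k)_k$ are sequences in $E$ such that $(P_Y(x_k))_k$ and $(G(z_k))_k$ are bounded and $$\lim_{k\to\infty}\bigl(f(x_k)-f(z_k)-\langle G(z_k),x_k-z_k\rangle\bigr)=0,$$ then $\lim_{k\to\infty}|G(x_k)-G(z_k)|=0$. Then there exists a convex function $F:\mathbb{R}^n\to\mathbb{R}$ of class $C^1$ such that $F(x)=f(x)$ and $\nabla F(x)=G(x)$ for all $x\in E$. -/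

import Mathlib

open Filter Topology

/-- The linear span of all differences `G x - G y`, for `x, y ∈ E`. -/
def differenceSpan {n : ℕ} {E : Set (EuclideanSpace ℝ (Fin n))}
    (G : E → EuclideanSpace ℝ (Fin n)) : Submodule ℝ (EuclideanSpace ℝ (Fin n)) :=
  Submodule.span ℝ {v | ∃ x y : E, v = G x - G y}

/-! Subtracting ⟨G x₀, ·⟩ and projecting to Y reduces to slopes that affinely span the space. Let m
be the supremum of the tangent planes. By (ii) it is finite, and planes nearly active on a bounded
set have bounded slopes; (iii) then makes m differentiable at the data points, uniformly on bounded
sets of them. But m need not be C¹ elsewhere.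

To smooth it, build H ≥ m touching m at the data: H is the infimum of the tangent planes, each plus
a bump that dominates the gap to m (`exists_gap`). The second differences of H are bounded above by
o(‖h‖), a property kept by infima when the bound is uniform. It also passes to the convex envelope F
of H, provided m is coercive (`UpperSmooth.exists_convex_between`); spanning slopes give coercivity
after subtracting a linear function. A convex function with this property is C¹
(`ConvexOn.contDiff_of_upperSmooth`). Since m ≤ F ≤ H, F takes the value f at each data point, where
the tangent plane supports m and hence F, so its slope is ∇F. -/

/-- The second differences of `H` are bounded above by `o(‖h‖)`, uniformly on bounded sets. -/
def UpperSmooth {V : Type*} [NormedAddCommGroup V] (H : V → ℝ) : Prop :=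
  ∀ R ε : ℝ, 0 < ε → ∃ δ > 0, ∀ x h : V, ‖x‖ ≤ R → ‖h‖ ≤ δ →
    H (x + h) + H (x - h) ≤ 2 * H x + ε * ‖h‖

theorem UpperSmooth.add {V : Type*} [NormedAddCommGroup V] {H K : V → ℝ} (hH : UpperSmooth H) (hK : UpperSmooth K) :
    UpperSmooth (fun x => H x + K x) := by
  intro R ε hε
  obtain ⟨δ, hδ, h1⟩ := hH R (ε / 2) (half_pos hε)
  obtain ⟨δ', hδ', h2⟩ := hK R (ε / 2) (half_pos hε)
  refine ⟨min δ δ', lt_min hδ hδ', fun x h hx hh => ?_⟩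
  have h3 := h1 x h hx (hh.trans (min_le_left _ _))
  have h4 := h2 x h hx (hh.trans (min_le_right _ _))
  linarith

/-! ### Convexity and small upper second differences give C¹. -/

section ConvexDifferentiability

variable {V : Type*} [NormedAddCommGroup V] [InnerProductSpace ℝ V]

theorem upperSmooth_inner (p : V) : UpperSmooth (fun x => inner ℝ p x) := by
  intro R ε hε
  refine ⟨1, one_pos, fun x h _ _ => ?_⟩
  simp only [inner_add_right, inner_sub_right]
  have := mul_nonneg hε.le (norm_nonneg h)
  linarith

theorem upperSmooth_mul_norm_sq (a : ℝ) : UpperSmooth (fun x : V => a * ‖x‖ ^ 2) := by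
  intro R ε hε
  refine ⟨ε / (2 * (|a| + 1)), by positivity, fun x h _ hh => ?_⟩
  have hp := parallelogram_law_with_norm ℝ x h
  have h1 : a * ‖x + h‖ ^ 2 + a * ‖x - h‖ ^ 2 = 2 * (a * ‖x‖ ^ 2) + 2 * a * ‖h‖ ^ 2 := by
    linear_combination a * hp
  rw [le_div_iff₀ (by positivity)] at hh
  have h2 : 2 * a * ‖h‖ ≤ ε := by
    nlinarith [le_abs_self a, norm_nonneg h]
  simp only [h1]
  nlinarith [norm_nonneg h]

theorem ConvexOn.continuous_of_univ [FiniteDimensional ℝ V] {F : V → ℝ}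
    (hF : ConvexOn ℝ Set.univ F) : Continuous F :=
  hF.locallyLipschitz.continuous

theorem exists_bound_closedBall [FiniteDimensional ℝ V] {F : V → ℝ} (hF : Continuous F) (R : ℝ) :
    ∃ C : ℝ, 0 ≤ C ∧ ∀ x : V, ‖x‖ ≤ R → |F x| ≤ C := by
  obtain ⟨C, hC⟩ := (isCompact_closedBall (0 : V) R).exists_bound_of_continuousOn hF.continuousOn
  exact ⟨max C 0, le_max_right _ _,
    fun x hx => (hC x (by simpa using hx)).trans (le_max_left _ _)⟩

theorem exists_unif_cont_closedBall [FiniteDimensional ℝ V] {F : V → ℝ} (hF : Continuous F)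
    (R : ℝ) {ε : ℝ} (hε : 0 < ε) :
    ∃ δ > 0, ∀ x y : V, ‖x‖ ≤ R → ‖y‖ ≤ R → ‖x - y‖ ≤ δ → |F x - F y| < ε := by
  have h := (isCompact_closedBall (0 : V) R).uniformContinuousOn_of_continuous hF.continuousOn
  rw [Metric.uniformContinuousOn_iff] at h
  obtain ⟨δ, hδ, h⟩ := h ε hε
  refine ⟨δ / 2, half_pos hδ, fun x y hx hy hxy => ?_⟩
  have := h x (by simpa using hx) y (by simpa using hy) (by rw [dist_eq_norm]; linarith)
  rwa [Real.dist_eq] at this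

/-- Separate (x, F x) from the open strict epigraph; the separating functional has positive vertical
component, so it can be normalised to a slope. -/
theorem ConvexOn.exists_subgradient [FiniteDimensional ℝ V] {F : V → ℝ}
    (hF : ConvexOn ℝ Set.univ F) (x : V) :
    ∃ p : V, ∀ h : V, F x + inner ℝ p h ≤ F (x + h) := by
  have hcont := hF.continuous_of_univ
  have hopen : IsOpen {q : V × ℝ | q.1 ∈ Set.univ ∧ F q.1 < q.2} := by
    simpa using isOpen_lt (hcont.comp continuous_fst) continuous_snd
  obtain ⟨L, hL⟩ := geometric_hahn_banach_point_open (x := (x, F x)) hF.convex_strict_epigraph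
    hopen (by simp)
  have hdec : ∀ (y : V) (t : ℝ), L (y, t) = L (y, 0) + t * L (0, 1) := by
    intro y t
    have : (y, t) = (y, (0 : ℝ)) + t • ((0 : V), (1 : ℝ)) := by simp
    rw [this, map_add, map_smul, smul_eq_mul]
  have hb : 0 < L (0, 1) := by
    have h1 := hL (x, F x + 1) (by simp)
    rw [hdec x (F x), hdec x (F x + 1)] at h1
    linarith
  set b := L (0, 1) with hbdef
  have hle : ∀ h : V, L (x, 0) + F x * b ≤ L (x + h, 0) + F (x + h) * b := by
    intro h
    refine le_of_forall_pos_lt_add fun ε hε => ?_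
    have h1 := hL (x + h, F (x + h) + ε / b) (by simp; positivity)
    rw [hdec x, hdec (x + h)] at h1
    have : ε / b * b = ε := by field_simp
    linarith
  let ℓ : V →L[ℝ] ℝ := L.comp (ContinuousLinearMap.inl ℝ V ℝ)
  refine ⟨(-b⁻¹) • (InnerProductSpace.toDual ℝ V).symm ℓ, fun h => ?_⟩
  rw [real_inner_smul_left, InnerProductSpace.toDual_symm_apply]
  have h2 := hle h
  have h3 : L (x + h, 0) = L (x, 0) + ℓ h := by
    have : (x + h, (0 : ℝ)) = (x, 0) + (h, 0) := by simp
    rw [this, map_add]; rfl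
  rw [h3] at h2
  have h4 : F x * b ≤ (F (x + h) + b⁻¹ * ℓ h) * b := by
    have : b⁻¹ * ℓ h * b = ℓ h := by field_simp
    linarith
  have h5 := le_of_mul_le_mul_right h4 hb
  linarith

/-- The subgradient inequality at -h turns the second-difference bound into an upper bound at h,
with δ independent of the point and of the subgradient. -/
theorem UpperSmooth.exists_gradient_bound {F : V → ℝ} (hF : UpperSmooth F) (R : ℝ) {ε : ℝ}
    (hε : 0 < ε) : ∃ δ > 0, ∀ x p : V, ‖x‖ ≤ R → (∀ h, F x + inner ℝ p h ≤ F (x + h)) →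
      ∀ h, ‖h‖ ≤ δ → F (x + h) ≤ F x + inner ℝ p h + ε * ‖h‖ := by
  obtain ⟨δ, hδ, H⟩ := hF R ε hε
  refine ⟨δ, hδ, fun x p hx hp h hh => ?_⟩
  have h1 := H x h hx hh
  have h2 := hp (-h)
  rw [inner_neg_right, ← sub_eq_add_neg x h] at h2
  linarith

theorem UpperSmooth.hasGradientAt [CompleteSpace V] {F : V → ℝ} (hF : UpperSmooth F) {x p : V}
    (hp : ∀ h, F x + inner ℝ p h ≤ F (x + h)) : HasGradientAt F p x := by
  rw [hasGradientAt_iff_isLittleO_nhds_zero, Asymptotics.isLittleO_iff]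
  intro ε hε
  obtain ⟨δ, hδ, H⟩ := hF.exists_gradient_bound ‖x‖ hε
  filter_upwards [Metric.closedBall_mem_nhds (0 : V) hδ] with h hh
  have h1 := H x p le_rfl hp h (by simpa using hh)
  have h2 := hp h
  rw [Real.norm_eq_abs, abs_le]
  have := mul_nonneg hε.le (norm_nonneg h)
  constructor <;> linarith

theorem ConvexOn.contDiff_of_upperSmooth [FiniteDimensional ℝ V] {F : V → ℝ}
    (hF : ConvexOn ℝ Set.univ F) (hS : UpperSmooth F) : ContDiff ℝ 1 F := by
  choose p hp using hF.exists_subgradient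
  have hgrad : ∀ x, HasGradientAt F (p x) x := fun x => hS.hasGradientAt (hp x)
  have hpc : Continuous p := by
    rw [Metric.continuous_iff]
    intro x ε hε
    obtain ⟨δ, hδ, H⟩ := hS.exists_gradient_bound ‖x‖ (show 0 < ε / 4 by positivity)
    obtain ⟨δ', hδ', H'⟩ := exists_unif_cont_closedBall hF.continuous_of_univ (‖x‖ + 1 + δ)
      (show 0 < ε / 8 * δ by positivity)
    refine ⟨min δ' 1, lt_min hδ' one_pos, fun y hy => ?_⟩
    rw [dist_eq_norm] at hy ⊢
    have hy1 : ‖y - x‖ < δ' := hy.trans_le (min_le_left _ _)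
    have hy2 : ‖y - x‖ < 1 := hy.trans_le (min_le_right _ _)
    have hyn : ‖y‖ ≤ ‖x‖ + 1 := by
      have := norm_add_le x (y - x)
      rw [add_sub_cancel] at this; linarith
    rcases eq_or_ne (p y - p x) 0 with h0 | h0
    · rw [h0, norm_zero]; exact hε
    have hn : 0 < ‖p y - p x‖ := norm_pos_iff.2 h0
    -- Moving distance δ along p y - p x compares the lower bound at y with the upper bound at x:
    -- δ‖p y - p x‖ < δε/4 + 2(δε/8).
    set h : V := (δ / ‖p y - p x‖) • (p y - p x) with hh
    have hhn : ‖h‖ = δ := by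
      rw [hh, norm_smul, Real.norm_of_nonneg (by positivity)]; field_simp
    have h1 := H x (p x) le_rfl (hp x) h hhn.le
    have h2 := hp y h
    have h3 := H' y x (by linarith) (by linarith) hy1.le
    have h4 := H' (y + h) (x + h) ((norm_add_le _ _).trans (by linarith))
      ((norm_add_le _ _).trans (by linarith)) (by simpa using hy1.le)
    have h5 : inner ℝ (p y) h - inner ℝ (p x) h = δ * ‖p y - p x‖ := by
      rw [← inner_sub_left, hh, real_inner_smul_right, real_inner_self_eq_norm_sq]; field_simp
    rw [abs_lt] at h3 h4
    rw [hhn] at h1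
    have h6 : δ * ‖p y - p x‖ < δ * ε := by nlinarith
    exact lt_of_mul_lt_mul_left h6 hδ.le
  rw [contDiff_one_iff_fderiv]
  refine ⟨fun x => (hgrad x).differentiableAt, ?_⟩
  have : fderiv ℝ F = fun x => InnerProductSpace.toDual ℝ V (p x) :=
    funext fun x => (hgrad x).hasFDerivAt.fderiv
  rw [this]
  exact (InnerProductSpace.toDual ℝ V).continuous.comp hpc

end ConvexDifferentiability

/-! ### Convex envelopes of upper smooth functions. -/

section ConvexEnvelope

variable {V : Type*} [NormedAddCommGroup V] [InnerProductSpace ℝ V]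

/-- A combination of points of the epigraph of `H` all of whose heavy part lies in `{H ≤ T}` can be
moved by `±h` at a cost which is controlled by the second differences of `H` on `{H ≤ T}`. -/
theorem exists_shift_mem_convexHull_epigraph {H : V → ℝ} {c T : ℝ} (hc : ∀ x, 0 ≤ H x + c)
    (hT : 0 < T + c) {x h : V} {t ε δ : ℝ}
    (hxt : (x, t) ∈ convexHull ℝ {q : V × ℝ | H q.1 ≤ q.2}) (htT : 2 * (t + c) ≤ T + c)
    (hδ : ‖h‖ ≤ δ / 2)
    (hH : ∀ y k : V, H y ≤ T → ‖k‖ ≤ δ → H (y + k) + H (y - k) ≤ 2 * H y + ε * ‖k‖) :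
    ∃ t₁ t₂ : ℝ, (x + h, t₁) ∈ convexHull ℝ {q : V × ℝ | H q.1 ≤ q.2} ∧
      (x - h, t₂) ∈ convexHull ℝ {q : V × ℝ | H q.1 ≤ q.2} ∧ t₁ + t₂ ≤ 2 * t + ε * ‖h‖ := by
  classical
  obtain ⟨κ, _, w, z, hw0, hw1, hz, hsum⟩ := mem_convexHull_iff_exists_fintype.1 hxt
  have hzx : ∑ i, w i • (z i).1 = x := by
    have := congrArg Prod.fst hsum
    simpa [Prod.fst_sum] using this
  have hzt : ∑ i, w i * (z i).2 = t := by
    have := congrArg Prod.snd hsum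
    simpa [Prod.snd_sum] using this
  let good : κ → Prop := fun i => H (z i).1 ≤ T
  let u : κ → ℝ := fun i => if good i then 1 else 0
  set μ : ℝ := ∑ i, w i * u i with hμ
  -- Markov's inequality: points with H > T carry at most half of the weight.
  have hbad : (1 - μ) * (T + c) ≤ t + c := by
    have h1 : (1 - μ) * (T + c) = ∑ i, w i * ((1 - u i) * (T + c)) := by
      have : 1 - μ = ∑ i, (w i - w i * u i) := by rw [Finset.sum_sub_distrib, hw1]
      rw [this, Finset.sum_mul]
      exact Finset.sum_congr rfl fun i _ => by ring
    have h2 : t + c = ∑ i, w i * ((z i).2 + c) := by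
      simp only [mul_add, Finset.sum_add_distrib, hzt, ← Finset.sum_mul, hw1, one_mul]
    rw [h1, h2]
    refine Finset.sum_le_sum fun i _ => mul_le_mul_of_nonneg_left ?_ (hw0 i)
    have h3 : H (z i).1 ≤ (z i).2 := hz i
    have h4 := hc (z i).1
    by_cases hg : good i
    · simp only [u, if_pos hg]; linarith
    · simp only [u, if_neg hg]
      have : T < H (z i).1 := not_le.1 hg
      linarith
  have hμ2 : 1 / 2 ≤ μ := by
    by_contra hlt
    push Not at hlt
    nlinarith
  have hμ0 : 0 < μ := by linarith
  -- Only the good points move, so the shift is rescaled to have weighted average h; μ ≥ 1/2 keeps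
  -- ‖k‖ ≤ 2‖h‖.
  set k : V := μ⁻¹ • h with hk
  have hkn : ‖k‖ = μ⁻¹ * ‖h‖ := by rw [hk, norm_smul, Real.norm_of_nonneg (by positivity)]
  have hkδ : ‖k‖ ≤ δ := by
    rw [hkn, inv_mul_le_iff₀ hμ0]
    nlinarith [norm_nonneg h]
  have key : ∀ s : ℝ, ((x + s • h, ∑ i, w i * (if good i then H ((z i).1 + s • k) else (z i).2))
      : V × ℝ) ∈ convexHull ℝ {q : V × ℝ | H q.1 ≤ q.2} := by
    intro s
    have : ((x + s • h, ∑ i, w i * (if good i then H ((z i).1 + s • k) else (z i).2)) : V × ℝ)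
        = ∑ i, w i • (((z i).1 + (u i * s) • k,
          if good i then H ((z i).1 + s • k) else (z i).2) : V × ℝ) := by
      refine Prod.ext ?_ ?_
      · simp only [Prod.fst_sum, Prod.smul_mk, smul_add, Finset.sum_add_distrib, hzx, smul_smul]
        rw [← Finset.sum_smul]
        have : ∑ i, w i * (u i * s) = s * μ := by
          rw [hμ, Finset.mul_sum]
          exact Finset.sum_congr rfl fun i _ => by ring
        rw [this, hk, smul_smul, mul_assoc, mul_inv_cancel₀ hμ0.ne', mul_one]
      · simp [Prod.snd_sum]
    rw [this]
    refine (convex_convexHull ℝ _).sum_mem (fun i _ => hw0 i) hw1 fun i _ =>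
      subset_convexHull ℝ _ ?_
    by_cases hg : good i
    · simp [u, hg]
    · simpa [u, hg] using hz i
  refine ⟨_, _, by simpa using key 1, by simpa [sub_eq_add_neg] using key (-1), ?_⟩
  have hfin : ε * ‖h‖ = ∑ i, w i * (u i * (ε * ‖k‖)) := by
    have : ∑ i, w i * (u i * (ε * ‖k‖)) = μ * (ε * ‖k‖) := by
      rw [hμ, Finset.sum_mul]
      exact Finset.sum_congr rfl fun i _ => by ring
    rw [this, hkn]; field_simp
  rw [hfin, ← hzt, Finset.mul_sum, ← Finset.sum_add_distrib, ← Finset.sum_add_distrib]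
  refine Finset.sum_le_sum fun i _ => ?_
  have hzi : H (z i).1 ≤ (z i).2 := hz i
  by_cases hg : good i
  · have h1 := hH (z i).1 k hg hkδ
    simp only [u, if_pos hg, ← sub_eq_add_neg]
    have := mul_le_mul_of_nonneg_left (h1.trans (by linarith :
      2 * H (z i).1 + ε * ‖k‖ ≤ 2 * (z i).2 + ε * ‖k‖)) (hw0 i)
    linarith
  · simp only [u, if_neg hg]
    linarith

/-- The envelope is read off the convex hull of the epigraph of H. Coercivity of m bounds {H ≤ T},
where the second differences of H are uniformly controlled. -/
theorem UpperSmooth.exists_convex_between [FiniteDimensional ℝ V] {H m : V → ℝ}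
    (hH : UpperSmooth H) (hm : ConvexOn ℝ Set.univ m) (hmH : ∀ x, m x ≤ H x)
    (hcoer : ∀ C : ℝ, ∃ R : ℝ, ∀ x, m x ≤ C → ‖x‖ ≤ R) :
    ∃ F : V → ℝ, ConvexOn ℝ Set.univ F ∧ UpperSmooth F ∧ (∀ x, m x ≤ F x) ∧ ∀ x, F x ≤ H x := by
  set S : Set (V × ℝ) := convexHull ℝ {q : V × ℝ | H q.1 ≤ q.2} with hS
  have hSm : ∀ q ∈ S, m q.1 ≤ q.2 := by
    intro q hq
    have : S ⊆ {q : V × ℝ | q.1 ∈ Set.univ ∧ m q.1 ≤ q.2} :=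
      convexHull_min (fun q hq => ⟨trivial, (hmH q.1).trans hq⟩) hm.convex_epigraph
    exact (this hq).2
  have hHS : ∀ x, (x, H x) ∈ S := fun x => subset_convexHull ℝ _ (le_refl (H x))
  have hbdd : ∀ x, BddBelow {t : ℝ | (x, t) ∈ S} := fun x => ⟨m x, fun t ht => hSm _ ht⟩
  have hne : ∀ x, {t : ℝ | (x, t) ∈ S}.Nonempty := fun x => ⟨H x, hHS x⟩
  set F : V → ℝ := fun x => sInf {t : ℝ | (x, t) ∈ S} with hF
  have hFle : ∀ {x t}, (x, t) ∈ S → F x ≤ t := fun {x t} h => csInf_le (hbdd x) h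
  have happ : ∀ x, ∀ e > 0, ∃ t, (x, t) ∈ S ∧ t < F x + e := by
    intro x e he
    obtain ⟨t, ht, hlt⟩ := exists_lt_of_csInf_lt (hne x) (show F x < F x + e by linarith)
    exact ⟨t, ht, hlt⟩
  have hmF : ∀ x, m x ≤ F x := fun x => le_csInf (hne x) fun t ht => hSm _ ht
  have hFc : ConvexOn ℝ Set.univ F := by
    refine ⟨convex_univ, fun x _ y _ a b ha hb hab => le_of_forall_pos_le_add fun e he => ?_⟩
    obtain ⟨t, ht, hte⟩ := happ x e he
    obtain ⟨s, hs, hse⟩ := happ y e he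
    have h1 : (a • x + b • y, a * t + b * s) ∈ S := by
      have := convex_convexHull ℝ _ ht hs ha hb hab
      simpa using this
    have h2 := hFle h1
    have h3 : a * t ≤ a * (F x + e) := mul_le_mul_of_nonneg_left hte.le ha
    have h4 : b * s ≤ b * (F y + e) := mul_le_mul_of_nonneg_left hse.le hb
    simp only [smul_eq_mul]
    have h5 : a * e + b * e = e := by rw [← add_mul, hab, one_mul]
    linarith
  refine ⟨F, hFc, ?_, hmF, fun x => hFle (hHS x)⟩
  obtain ⟨c, hc0, hc⟩ : ∃ c : ℝ, 0 ≤ c ∧ ∀ x, 0 ≤ m x + c := by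
    obtain ⟨R, hR⟩ := hcoer 0
    obtain ⟨C, hC0, hC⟩ := exists_bound_closedBall hm.continuous_of_univ R
    refine ⟨C, hC0, fun x => ?_⟩
    by_cases hx : m x ≤ 0
    · have := (abs_le.1 (hC x (hR x hx))).1; linarith
    · push Not at hx; linarith
  intro R ε hε
  obtain ⟨C, hC0, hC⟩ := exists_bound_closedBall hFc.continuous_of_univ R
  -- Makes 2(t + c) ≤ T + c for every height t < F x + 1 ≤ C + 1.
  set T : ℝ := 2 * (C + 1 + c) - c with hT
  obtain ⟨R', hR'⟩ := hcoer T
  obtain ⟨δ, hδ, hHδ⟩ := hH R' ε hε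
  refine ⟨δ / 2, half_pos hδ, fun x h hx hh => le_of_forall_pos_le_add fun e he => ?_⟩
  obtain ⟨t, ht, hte⟩ := happ x (min (e / 2) 1) (lt_min (half_pos he) one_pos)
  have hte1 : t < F x + e / 2 := hte.trans_le (by have := min_le_left (e / 2) 1; linarith)
  have hte2 : t < F x + 1 := hte.trans_le (by have := min_le_right (e / 2) 1; linarith)
  have hFx := (abs_le.1 (hC x hx)).2
  obtain ⟨t₁, t₂, h1, h2, h3⟩ := exists_shift_mem_convexHull_epigraph (H := H) (c := c) (T := T)
    (fun y => by linarith [hc y, hmH y]) (by linarith) ht (by linarith) hh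
    (fun y k hy hk => hHδ y k (hR' y ((hmH y).trans hy)) hk)
  have h4 := hFle h1
  have h5 := hFle h2
  linarith

end ConvexEnvelope

/-! ### Radial upper smooth majorants. -/

section Majorant

/-- A convex function `θ ≥ 0` on the line with `θ t = o(t)` at `0` is dominated on `[0, ∞)` by a
primitive of a continuous nonnegative function vanishing at `0`. -/
theorem ConvexOn.exists_le_primitive {θ : ℝ → ℝ} (hθ : ConvexOn ℝ Set.univ θ) (h0 : θ 0 = 0)
    (hpos : ∀ t, 0 ≤ θ t) (hsmall : ∀ ε > 0, ∃ δ > 0, ∀ t, |t| ≤ δ → θ t ≤ ε * |t|) :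
    ∃ η : ℝ → ℝ, Continuous η ∧ η 0 = 0 ∧ (∀ t, 0 ≤ η t) ∧
      ∀ t, 0 ≤ t → θ t ≤ ∫ s in (0 : ℝ)..t, η s := by
  have hθc : Continuous θ := hθ.locallyLipschitz.continuous
  set σ : ℝ → ℝ := fun t => θ t / |t| with hσ
  -- Division by zero gives 0, which is also the limit of σ at 0.
  have hσ0 : σ 0 = 0 := by simp [hσ]
  have hσpos : ∀ t, 0 ≤ σ t := fun t => div_nonneg (hpos t) (abs_nonneg t)
  have hσc : Continuous σ := by
    rw [continuous_iff_continuousAt]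
    intro t
    rcases eq_or_ne t 0 with rfl | ht
    · rw [Metric.continuousAt_iff]
      intro ε hε
      obtain ⟨δ, hδ, h⟩ := hsmall (ε / 2) (half_pos hε)
      refine ⟨δ, hδ, fun {s} hs => ?_⟩
      rw [Real.dist_eq, sub_zero] at hs
      rw [hσ0, Real.dist_eq, sub_zero, abs_of_nonneg (hσpos s)]
      have h1 : σ s ≤ ε / 2 := div_le_of_le_mul₀ (abs_nonneg s) (half_pos hε).le (h s hs.le)
      linarith
    · exact hθc.continuousAt.div continuous_abs.continuousAt (abs_ne_zero.2 ht)
  have hmono : ∀ s t, 0 < t → t ≤ s → σ t ≤ σ s := by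
    intro s t ht hts
    have hs : 0 < s := ht.trans_le hts
    have h1 := hθ.2 (Set.mem_univ s) (Set.mem_univ 0) (show 0 ≤ t / s by positivity)
      (show 0 ≤ 1 - t / s by rw [sub_nonneg, div_le_one hs]; exact hts) (by ring)
    simp only [smul_eq_mul, mul_zero, add_zero, h0] at h1
    rw [div_mul_cancel₀ _ hs.ne'] at h1
    simp only [hσ, abs_of_pos ht, abs_of_pos hs]
    rw [div_le_div_iff₀ ht hs]
    have h2 : t / s * θ s * s = θ s * t := by field_simp
    nlinarith
  -- Since σ is nondecreasing on (0, ∞), the integral of 2σ(2s) over [t/2, t] is at least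
  -- (t/2)·2σ(t) = θ t.
  have hηc : Continuous fun s => 2 * σ (2 * s) := by fun_prop
  refine ⟨fun s => 2 * σ (2 * s), hηc, by simp [hσ0], fun t => by have := hσpos (2 * t); positivity,
    fun t ht => ?_⟩
  rcases ht.eq_or_lt with rfl | ht
  · simp [h0]
  have hint : ∀ a b, IntervalIntegrable (fun s => 2 * σ (2 * s)) MeasureTheory.volume a b :=
    fun a b => hηc.intervalIntegrable a b
  rw [← intervalIntegral.integral_add_adjacent_intervals (hint 0 (t / 2)) (hint (t / 2) t)]
  have h1 : 0 ≤ ∫ s in (0 : ℝ)..(t / 2), 2 * σ (2 * s) :=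
    intervalIntegral.integral_nonneg (by linarith) fun s _ => by
      have := hσpos (2 * s); positivity
  have h2 : ∫ _ in (t / 2)..t, 2 * σ t ≤ ∫ s in (t / 2)..t, 2 * σ (2 * s) := by
    refine intervalIntegral.integral_mono_on (by linarith) (by simp) (hint _ _) fun s hs => ?_
    have := hmono (2 * s) t ht (by linarith [hs.1])
    linarith
  rw [intervalIntegral.integral_const, smul_eq_mul] at h2
  have h3 : (t - t / 2) * (2 * σ t) = θ t := by
    simp only [hσ, abs_of_pos ht]; field_simp; ring
  linarith

variable {V : Type*} [NormedAddCommGroup V] [InnerProductSpace ℝ V]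

theorem norm_add_add_norm_sub_le (x h : V) : (‖x + h‖ + ‖x - h‖ - 2 * ‖x‖) * ‖x‖ ≤ ‖h‖ ^ 2 := by
  have hp := parallelogram_law_with_norm ℝ x h
  nlinarith [sq_nonneg (‖x + h‖ - ‖x‖), sq_nonneg (‖x - h‖ - ‖x‖)]

/-- Near the origin, where the norm has a kink, η is small; away from it the second difference of
the norm is O(‖h‖²). -/
theorem upperSmooth_primitive_norm {η : ℝ → ℝ} (hη : Continuous η) (h0 : η 0 = 0)
    (hpos : ∀ t, 0 ≤ η t) : UpperSmooth (fun x : V => ∫ s in (0 : ℝ)..‖x‖, η s) := by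
  intro R ε hε
  set ω : ℝ → ℝ := fun t => ∫ s in (0 : ℝ)..t, η s with hω
  obtain ⟨C, hC0, hC⟩ := exists_bound_closedBall hη R
  obtain ⟨δ, hδ, hδη⟩ := exists_unif_cont_closedBall hη (R + 1) (show 0 < ε / 4 by positivity)
  have hexp : ∀ a b, 0 ≤ a → 0 ≤ b → a ≤ R → b ≤ R + 1 → |b - a| ≤ δ →
      ω b ≤ ω a + η a * (b - a) + ε / 4 * |b - a| := by
    intro a b ha hb haR hbR hab
    have h1 : ω b - ω a = ∫ s in a..b, η s :=
      intervalIntegral.integral_interval_sub_left (hη.intervalIntegrable _ _)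
        (hη.intervalIntegrable _ _)
    have h2 : ∫ s in a..b, (η s - η a) = (ω b - ω a) - η a * (b - a) := by
      rw [intervalIntegral.integral_sub (hη.intervalIntegrable _ _) (by simp), ← h1,
        intervalIntegral.integral_const, smul_eq_mul, mul_comm]
    have h3 : ‖∫ s in a..b, (η s - η a)‖ ≤ ε / 4 * |b - a| := by
      refine intervalIntegral.norm_integral_le_of_norm_le_const fun s hs => ?_
      have hs' := Set.uIoc_subset_uIcc hs
      have h4 := Set.abs_sub_left_of_mem_uIcc hs'
      rw [Set.mem_uIcc] at hs'
      refine (hδη s a ?_ ?_ (by rw [Real.norm_eq_abs]; exact h4.trans hab)).le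
      · rw [Real.norm_eq_abs, abs_le]
        rcases hs' with h | h <;> constructor <;> linarith [h.1, h.2]
      · rw [Real.norm_eq_abs, abs_of_nonneg ha]; linarith
    rw [h2, Real.norm_eq_abs, abs_le] at h3
    linarith [h3.2]
  refine ⟨min (min δ 1) (ε * δ / (4 * (C + 1))), by positivity, fun x h hx hh => ?_⟩
  have hh1 : ‖h‖ ≤ δ := hh.trans ((min_le_left _ _).trans (min_le_left _ _))
  have hh2 : ‖h‖ ≤ 1 := hh.trans ((min_le_left _ _).trans (min_le_right _ _))
  have hh3 : ‖h‖ * (4 * (C + 1)) ≤ ε * δ := by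
    rw [← le_div_iff₀ (by positivity)]; exact hh.trans (min_le_right _ _)
  have hd1 : |‖x + h‖ - ‖x‖| ≤ ‖h‖ := by
    have := abs_norm_sub_norm_le (x + h) x; simpa using this
  have hd2 : |‖x - h‖ - ‖x‖| ≤ ‖h‖ := by
    have := abs_norm_sub_norm_le (x - h) x
    rwa [sub_sub_cancel_left, norm_neg] at this
  have e1 := hexp ‖x‖ ‖x + h‖ (norm_nonneg _) (norm_nonneg _) hx
    ((norm_add_le _ _).trans (by linarith)) (hd1.trans hh1)
  have e2 := hexp ‖x‖ ‖x - h‖ (norm_nonneg _) (norm_nonneg _) hx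
    ((norm_sub_le _ _).trans (by linarith)) (hd2.trans hh1)
  set D : ℝ := ‖x + h‖ + ‖x - h‖ - 2 * ‖x‖ with hD
  have hD1 : D ≤ 2 * ‖h‖ := by linarith [(abs_le.1 hd1).2, (abs_le.1 hd2).2]
  have hD2 : D * ‖x‖ ≤ ‖h‖ ^ 2 := norm_add_add_norm_sub_le x h
  have hmain : η ‖x‖ * D ≤ ε / 2 * ‖h‖ := by
    rcases le_total ‖x‖ δ with hxδ | hxδ
    · have h1 : η ‖x‖ ≤ ε / 4 := by
        have := hδη ‖x‖ 0 (by rw [norm_norm]; linarith)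
          (by rw [norm_zero]; linarith [norm_nonneg x]) (by simpa using hxδ)
        rw [h0, sub_zero, abs_lt] at this
        exact this.2.le
      calc η ‖x‖ * D ≤ η ‖x‖ * (2 * ‖h‖) := mul_le_mul_of_nonneg_left hD1 (hpos _)
        _ ≤ ε / 4 * (2 * ‖h‖) := mul_le_mul_of_nonneg_right h1 (by positivity)
        _ = ε / 2 * ‖h‖ := by ring
    · have h1 : η ‖x‖ ≤ C := (le_abs_self _).trans (hC ‖x‖ (by rwa [norm_norm]))
      have h2 : D * δ ≤ ‖h‖ ^ 2 := by
        rcases le_total 0 D with hD0 | hD0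
        · exact (mul_le_mul_of_nonneg_left hxδ hD0).trans hD2
        · exact (mul_nonpos_of_nonpos_of_nonneg hD0 hδ.le).trans (sq_nonneg _)
      have h3 : η ‖x‖ * D * δ ≤ C * ‖h‖ ^ 2 := by
        calc η ‖x‖ * D * δ = η ‖x‖ * (D * δ) := by ring
          _ ≤ η ‖x‖ * ‖h‖ ^ 2 := mul_le_mul_of_nonneg_left h2 (hpos _)
          _ ≤ C * ‖h‖ ^ 2 := mul_le_mul_of_nonneg_right h1 (sq_nonneg _)
      have h4 : C * ‖h‖ ^ 2 ≤ (ε / 2 * ‖h‖) * δ := by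
        have : C * ‖h‖ ≤ ε / 2 * δ := by nlinarith [norm_nonneg h]
        nlinarith [norm_nonneg h]
      exact le_of_mul_le_mul_right (h3.trans h4) hδ
  have hfin : ω ‖x + h‖ + ω ‖x - h‖ ≤ 2 * ω ‖x‖ + η ‖x‖ * D + ε / 2 * ‖h‖ := by
    have h1 : ε / 4 * |‖x + h‖ - ‖x‖| ≤ ε / 4 * ‖h‖ := mul_le_mul_of_nonneg_left hd1 (by positivity)
    have h2 : ε / 4 * |‖x - h‖ - ‖x‖| ≤ ε / 4 * ‖h‖ := mul_le_mul_of_nonneg_left hd2 (by positivity)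
    rw [hD]; linarith
  change ω ‖x + h‖ + ω ‖x - h‖ ≤ 2 * ω ‖x‖ + ε * ‖h‖
  linarith

/-- The supremum of g k (t • u) over k and ‖u‖ ≤ 1 is convex in t, which reduces the problem to the
line. -/
theorem exists_upperSmooth_majorant {κ : Type*} {g : κ → V → ℝ}
    (hconv : ∀ k, ConvexOn ℝ Set.univ (g k)) (hg0 : ∀ k, g k 0 = 0)
    (hbdd : ∀ R : ℝ, ∃ C : ℝ, ∀ k h, ‖h‖ ≤ R → g k h ≤ C)
    (hsmall : ∀ ε > 0, ∃ δ > 0, ∀ k h, ‖h‖ ≤ δ → g k h ≤ ε * ‖h‖) :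
    ∃ φ : V → ℝ, UpperSmooth φ ∧ Continuous φ ∧ φ 0 = 0 ∧ ∀ k h, g k h ≤ φ h := by
  rcases isEmpty_or_nonempty κ with hκ | hκ
  · exact ⟨fun _ => 0, fun R ε hε => ⟨1, one_pos, fun x h _ _ => by
      have := mul_nonneg hε.le (norm_nonneg h); linarith⟩, continuous_const, rfl,
      fun k => hκ.elim k⟩
  -- The closed ball rather than the sphere: u = 0 gives θ ≥ 0, and the index set is nonempty even
  -- if V is trivial.
  let ι := κ × Metric.closedBall (0 : V) 1
  have : Nonempty ι := ⟨(hκ.some, ⟨0, by simp⟩)⟩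
  have hu : ∀ p : ι, ‖(p.2 : V)‖ ≤ 1 := fun p => mem_closedBall_zero_iff.1 p.2.2
  have hsm : ∀ (t : ℝ) (p : ι), ‖t • (p.2 : V)‖ ≤ |t| := fun t p => by
    rw [norm_smul, Real.norm_eq_abs]
    exact mul_le_of_le_one_right (abs_nonneg t) (hu p)
  set θ : ℝ → ℝ := fun t => ⨆ p : ι, g p.1 (t • (p.2 : V)) with hθ
  have hba : ∀ t : ℝ, BddAbove (Set.range fun p : ι => g p.1 (t • (p.2 : V))) := by
    intro t
    obtain ⟨C, hC⟩ := hbdd |t|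
    exact ⟨C, by rintro _ ⟨p, rfl⟩; exact hC _ _ (hsm t p)⟩
  have hle : ∀ (t : ℝ) (p : ι), g p.1 (t • (p.2 : V)) ≤ θ t := fun t p => le_ciSup (hba t) p
  have hpos : ∀ t, 0 ≤ θ t := fun t => by
    have := hle t (hκ.some, ⟨0, by simp⟩)
    simpa [hg0] using this
  have hθconv : ConvexOn ℝ Set.univ θ := by
    refine ⟨convex_univ, fun s _ t _ a b ha hb hab => ciSup_le fun p => ?_⟩
    have h1 := (hconv p.1).2 (Set.mem_univ (s • (p.2 : V))) (Set.mem_univ (t • (p.2 : V))) ha hb hab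
    have h2 : a • s • (p.2 : V) + b • t • (p.2 : V) = (a • s + b • t) • (p.2 : V) := by
      simp only [smul_smul, ← add_smul, smul_eq_mul]
    rw [h2] at h1
    exact h1.trans (add_le_add (mul_le_mul_of_nonneg_left (hle s p) ha)
      (mul_le_mul_of_nonneg_left (hle t p) hb))
  obtain ⟨η, hηc, hη0, hηpos, hηle⟩ := hθconv.exists_le_primitive (by simp [hθ, hg0]) hpos (by
    intro ε hε
    obtain ⟨δ, hδ, h⟩ := hsmall ε hε
    refine ⟨δ, hδ, fun t ht => ciSup_le fun p => ?_⟩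
    exact (h _ _ ((hsm t p).trans ht)).trans (mul_le_mul_of_nonneg_left (hsm t p) hε.le))
  refine ⟨_, upperSmooth_primitive_norm hηc hη0 hηpos,
    (intervalIntegral.continuous_primitive (fun a b => hηc.intervalIntegrable a b) 0).comp
      continuous_norm, by simp, fun k h => le_trans ?_ (hηle ‖h‖ (norm_nonneg h))⟩
  have h1 := hle ‖h‖ (k, ⟨‖h‖⁻¹ • h, by
    rw [mem_closedBall_zero_iff, norm_smul, norm_inv, norm_norm]; exact inv_mul_le_one⟩)
  rcases eq_or_ne h 0 with rfl | hh
  · simpa using h1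
  · simpa [smul_smul, mul_inv_cancel₀ (norm_ne_zero_iff.2 hh)] using h1

end Majorant

/-! ### Extension of convex jets with spanning slopes. -/

section ConvexJets

variable {V : Type*} [NormedAddCommGroup V] [InnerProductSpace ℝ V] {ι : Type*}

/-- A family of `1`-jets `(f i, G i)` at the points `x i` that is convex, whose dual values
`⟪G i, x i⟫ - f i` grow faster than linearly in `‖G i‖`, and in which two planes that nearly
coincide at a point `x i` have nearly equal slopes. -/
structure IsConvexJet (x : ι → V) (f : ι → ℝ) (G : ι → V) : Prop where
  le : ∀ i j, f j + inner ℝ (G j) (x i - x j) ≤ f i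
  growth : ∀ M : ℝ, ∃ C : ℝ, ∀ i, M * ‖G i‖ ≤ inner ℝ (G i) (x i) - f i + C
  close : ∀ R ε : ℝ, 0 < ε → ∃ δ > 0, ∀ i j, ‖x i‖ ≤ R → ‖G j‖ ≤ R →
    f i - f j - inner ℝ (G j) (x i - x j) < δ → ‖G i - G j‖ < ε

/-- The supremum of the tangent planes of a family of `1`-jets. -/
noncomputable def minimalExtension (x : ι → V) (f : ι → ℝ) (G : ι → V) (y : V) : ℝ :=
  ⨆ i, (f i + inner ℝ (G i) (y - x i))

variable {x : ι → V} {f : ι → ℝ} {G : ι → V}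

namespace IsConvexJet

/-- Growth with M = R + 1 leaves a spare ‖G i‖, which later bounds the slopes of nearly active
planes. -/
theorem exists_plane_le (hJ : IsConvexJet x f G) (R : ℝ) :
    ∃ C : ℝ, ∀ i y, ‖y‖ ≤ R → f i + inner ℝ (G i) (y - x i) + ‖G i‖ ≤ C := by
  obtain ⟨C, hC⟩ := hJ.growth (R + 1)
  refine ⟨C, fun i y hy => ?_⟩
  have h1 := hC i
  have h2 := real_inner_le_norm (G i) y
  have h3 := mul_le_mul_of_nonneg_left hy (norm_nonneg (G i))
  rw [inner_sub_right]
  linarith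

theorem bddAbove (hJ : IsConvexJet x f G) (y : V) :
    BddAbove (Set.range fun i => f i + inner ℝ (G i) (y - x i)) := by
  obtain ⟨C, hC⟩ := hJ.exists_plane_le ‖y‖
  refine ⟨C, ?_⟩
  rintro _ ⟨i, rfl⟩
  have := hC i y le_rfl
  have := norm_nonneg (G i)
  dsimp only; linarith

theorem plane_le (hJ : IsConvexJet x f G) (i : ι) (y : V) :
    f i + inner ℝ (G i) (y - x i) ≤ minimalExtension x f G y :=
  le_ciSup (hJ.bddAbove y) i

theorem minimalExtension_apply (hJ : IsConvexJet x f G) (i : ι) :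
    minimalExtension x f G (x i) = f i := by
  have : Nonempty ι := ⟨i⟩
  refine le_antisymm (ciSup_le fun j => hJ.le i j) ?_
  simpa using hJ.plane_le i (x i)

theorem convexOn [Nonempty ι] (hJ : IsConvexJet x f G) :
    ConvexOn ℝ Set.univ (minimalExtension x f G) := by
  refine ⟨convex_univ, fun y _ z _ a b ha hb hab => ciSup_le fun i => ?_⟩
  have h1 := mul_le_mul_of_nonneg_left (hJ.plane_le i y) ha
  have h2 := mul_le_mul_of_nonneg_left (hJ.plane_le i z) hb
  have h3 : f i + inner ℝ (G i) (a • y + b • z - x i)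
      = a * (f i + inner ℝ (G i) (y - x i)) + b * (f i + inner ℝ (G i) (z - x i)) := by
    simp only [inner_sub_right, inner_add_right, real_inner_smul_right]
    linear_combination (inner ℝ (G i) (x i) - f i) * hab
  rw [h3]
  exact add_le_add h1 h2

variable [FiniteDimensional ℝ V]

theorem exists_norm_slope_le [Nonempty ι] (hJ : IsConvexJet x f G) (R : ℝ) :
    ∃ B : ℝ, 0 ≤ B ∧ ∀ i y, ‖y‖ ≤ R →
      minimalExtension x f G y ≤ f i + inner ℝ (G i) (y - x i) + 1 → ‖G i‖ ≤ B := by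
  obtain ⟨C, hC⟩ := hJ.exists_plane_le R
  obtain ⟨K, -, hK⟩ := exists_bound_closedBall hJ.convexOn.continuous_of_univ R
  refine ⟨max (C + 1 + K) 0, le_max_right _ _, fun i y hy h => le_max_of_le_left ?_⟩
  have h1 := hC i y hy
  have h2 := (abs_le.1 (hK y hy)).1
  linarith

/-- The minimal extension is differentiable at the points `x i`, uniformly over bounded sets
of such points. -/
theorem minimalExtension_sub_plane_le [Nonempty ι] (hJ : IsConvexJet x f G) (R : ℝ) {ε : ℝ}
    (hε : 0 < ε) :
    ∃ δ > 0, ∀ i h, ‖x i‖ ≤ R → ‖h‖ ≤ δ →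
      minimalExtension x f G (x i + h) - (f i + inner ℝ (G i) h) ≤ ε * ‖h‖ := by
  obtain ⟨B, hB0, hB⟩ := hJ.exists_norm_slope_le (R + 1)
  obtain ⟨δ₁, hδ₁, hclose⟩ := hJ.close (max R B) (ε / 2) (half_pos hε)
  obtain ⟨δ₂, hδ₂, hunif⟩ := exists_unif_cont_closedBall hJ.convexOn.continuous_of_univ (R + 1)
    (show 0 < δ₁ / 3 by positivity)
  refine ⟨min (min δ₂ 1) (min (δ₁ / (3 * (B + 1))) (min (δ₁ / (3 * ε)) (1 / ε))), by positivity,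
    fun i h hi hh => ?_⟩
  simp only [le_min_iff] at hh
  obtain ⟨⟨hh1, hh2⟩, hh3, hh4, hh5⟩ := hh
  rw [le_div_iff₀ (by positivity)] at hh3 hh4 hh5
  rcases eq_or_ne h 0 with rfl | h0
  · simp [hJ.minimalExtension_apply]
  have hn : 0 < ‖h‖ := norm_pos_iff.2 h0
  have hpos : 0 < ε / 2 * ‖h‖ := by positivity
  -- A plane z nearly active at x i + h is also nearly active at x i, since its slope is at most B;
  -- `close` then makes its slope close to G i.
  obtain ⟨z, hz⟩ := exists_lt_of_lt_ciSup (show minimalExtension x f G (x i + h) - ε / 2 * ‖h‖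
    < ⨆ j, (f j + inner ℝ (G j) (x i + h - x j)) from sub_lt_self _ hpos)
  have hxh : ‖x i + h‖ ≤ R + 1 := (norm_add_le _ _).trans (add_le_add hi hh2)
  have hGz : ‖G z‖ ≤ B := hB z (x i + h) hxh (by linarith)
  have hu := hunif (x i + h) (x i) hxh (by linarith) (by simpa using hh1)
  rw [hJ.minimalExtension_apply, abs_lt] at hu
  have hsplit : (inner ℝ (G z) (x i + h - x z) : ℝ)
      = inner ℝ (G z) (x i - x z) + inner ℝ (G z) h := by
    rw [← inner_add_right]; congr 1; abel
  have hin : (inner ℝ (G z) h : ℝ) ≤ B * ‖h‖ :=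
    (real_inner_le_norm _ _).trans (mul_le_mul_of_nonneg_right hGz hn.le)
  have hlt := hclose i z (hi.trans (le_max_left _ _)) (hGz.trans (le_max_right _ _)) (by
    nlinarith [hu.1])
  have hin2 : (inner ℝ (G z - G i) h : ℝ) ≤ ε / 2 * ‖h‖ := by
    refine (real_inner_le_norm _ _).trans (mul_le_mul_of_nonneg_right ?_ hn.le)
    rw [norm_sub_rev]; exact hlt.le
  rw [inner_sub_left] at hin2
  have hle := hJ.le i z
  linarith

/-- For the points `x i` in a bounded set, the minimal extension lies below the tangent plane plus
a common upper smooth function. -/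
theorem exists_gap [Nonempty ι] (hJ : IsConvexJet x f G) (N : ℝ) :
    ∃ φ : V → ℝ, UpperSmooth φ ∧ Continuous φ ∧ φ 0 = 0 ∧ ∀ i, ‖x i‖ ≤ N →
      (∀ h, minimalExtension x f G (x i + h) ≤ f i + inner ℝ (G i) h + φ h) ∧
      ∀ h, 1 ≤ ‖h‖ → N ≤ f i + inner ℝ (G i) h + φ h := by
  have hm := hJ.convexOn
  set m := minimalExtension x f G with hmdef
  obtain ⟨B, hB0, hB⟩ := hJ.exists_norm_slope_le N
  have hBi : ∀ i, ‖x i‖ ≤ N → ‖G i‖ ≤ B := fun i hi => hB i (x i) hi (by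
    rw [hJ.minimalExtension_apply]; simp)
  obtain ⟨K, hK0, hK⟩ := exists_bound_closedBall hm.continuous_of_univ N
  have hfi : ∀ i, ‖x i‖ ≤ N → |f i| ≤ K := fun i hi => by
    have := hK (x i) hi
    rwa [hmdef, hJ.minimalExtension_apply] at this
  have hinner : ∀ i h, ‖x i‖ ≤ N → |(inner ℝ (G i) h : ℝ)| ≤ B * ‖h‖ := fun i h hi =>
    (abs_real_inner_le_norm _ _).trans (mul_le_mul_of_nonneg_right (hBi i hi) (norm_nonneg h))
  obtain ⟨φ, hφS, hφc, hφ0, hφ⟩ := exists_upperSmooth_majorant (κ := {i // ‖x i‖ ≤ N})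
    (g := fun i h => m (x i + h) - (f i + inner ℝ (G i) h))
    (by
      intro i
      refine ⟨convex_univ, fun y _ z _ a b ha hb hab => ?_⟩
      have h1 := hm.2 (Set.mem_univ (x i + y)) (Set.mem_univ (x i + z)) ha hb hab
      have h2 : a • (x i + y) + b • (x i + z) = x i + (a • y + b • z) := by
        have : (x i : V) = (a + b) • x i := by rw [hab, one_smul]
        conv_rhs => rw [this]
        simp only [smul_add, add_smul]; abel
      rw [h2] at h1
      simp only [smul_eq_mul, inner_add_right, real_inner_smul_right] at h1 ⊢
      linear_combination h1 + f i * hab)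
    (by intro i; simp [hmdef, hJ.minimalExtension_apply])
    (by
      intro R
      obtain ⟨K', -, hK'⟩ := exists_bound_closedBall hm.continuous_of_univ (N + R)
      refine ⟨K' + K + B * R, fun i h hh => ?_⟩
      have h1 := (abs_le.1 (hK' (x i + h) ((norm_add_le _ _).trans (add_le_add i.2 hh)))).2
      have h2 := (abs_le.1 (hfi i i.2)).1
      have h3 := (abs_le.1 (hinner i h i.2)).1
      have h4 := mul_le_mul_of_nonneg_left hh hB0
      linarith)
    (by
      intro ε hε
      obtain ⟨δ, hδ, h⟩ := hJ.minimalExtension_sub_plane_le N hε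
      exact ⟨δ, hδ, fun i y hy => h i y i.2 hy⟩)
  -- For ‖h‖ ≥ 1, a‖h‖² outweighs |f i| ≤ K, |⟨G i, h⟩| ≤ B‖h‖ and N. This makes distant data
  -- irrelevant to the infimum defining H.
  set a : ℝ := 2 * K + 2 * B + |N| with ha
  have ha0 : 0 ≤ a := by positivity
  refine ⟨fun h => φ h + a * ‖h‖ ^ 2, hφS.add (upperSmooth_mul_norm_sq a), by fun_prop,
    by simp [hφ0], fun i hi => ⟨fun h => ?_, fun h hh => ?_⟩⟩
  · have h1 := hφ ⟨i, hi⟩ h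
    have h2 : 0 ≤ a * ‖h‖ ^ 2 := by positivity
    dsimp only at h1
    linarith
  · have h1 := hφ ⟨i, hi⟩ h
    have h2 := hJ.plane_le i (x i + h)
    rw [add_sub_cancel_left] at h2
    have h3 := (abs_le.1 (hfi i hi)).1
    have h4 := (abs_le.1 (hinner i h hi)).1
    have h5 : a * ‖h‖ ≤ a * ‖h‖ ^ 2 := by
      refine mul_le_mul_of_nonneg_left ?_ ha0
      nlinarith
    have h6 := le_abs_self N
    have h7 : (2 * K + |N|) * 1 ≤ (2 * K + |N|) * ‖h‖ :=
      mul_le_mul_of_nonneg_left hh (by positivity)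
    have h8 : a * ‖h‖ = (2 * K + |N|) * ‖h‖ + 2 * B * ‖h‖ := by rw [ha]; ring
    have h9 : 0 ≤ B * ‖h‖ := by positivity
    dsimp only at h1
    linarith

/-- There is an upper smooth function above the minimal extension that touches it at every `x i`. -/
theorem exists_upperSmooth_above [Nonempty ι] (hJ : IsConvexJet x f G) :
    ∃ H : V → ℝ, UpperSmooth H ∧ (∀ y, minimalExtension x f G y ≤ H y) ∧ ∀ i, H (x i) ≤ f i := by
  choose φ hφS hφc hφ0 hφ using fun N : ℕ => hJ.exists_gap (N : ℝ)
  set m := minimalExtension x f G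
  let N : ι → ℕ := fun i => ⌈‖x i‖⌉₊
  have hN : ∀ i, ‖x i‖ ≤ N i := fun i => Nat.le_ceil _
  let ψ : ι → V → ℝ := fun i y => f i + inner ℝ (G i) (y - x i) + φ (N i) (y - x i)
  have hψm : ∀ i y, m y ≤ ψ i y := fun i y => by
    simpa using (hφ (N i) i (hN i)).1 (y - x i)
  have hbdd : ∀ y, BddBelow (Set.range fun i => ψ i y) := fun y =>
    ⟨m y, by rintro _ ⟨i, rfl⟩; exact hψm i y⟩
  set H : V → ℝ := fun y => ⨅ i, ψ i y with hH
  have hHψ : ∀ i y, H y ≤ ψ i y := fun i y => ciInf_le (hbdd y) i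
  refine ⟨H, ?_, fun y => le_ciInf fun i => hψm i y, fun i => by
    simpa [ψ, hφ0] using hHψ i (x i)⟩
  intro R ε hε
  let i₀ : ι := Classical.arbitrary ι
  have hψc : Continuous (ψ i₀) := by
    have := hφc (N i₀)
    fun_prop
  obtain ⟨C, -, hC⟩ := exists_bound_closedBall hψc R
  -- If N i ≥ L, then y is at distance at least 1 from x i, so ψ i y ≥ N i > C + 1 and i is not
  -- nearly minimal. Only finitely many φ n matter on the ball of radius R.
  obtain ⟨L, hL⟩ := exists_nat_gt (max (C + 1) (R + 2))
  have hL1 : C + 1 < L := (le_max_left _ _).trans_lt hL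
  have hL2 : R + 2 < L := (le_max_right _ _).trans_lt hL
  choose δ hδ hδφ using fun n : ℕ => hφS n (R + n) ε hε
  obtain ⟨d, hd, hdδ⟩ : ∃ d > 0, ∀ n < L, d ≤ δ n := by
    clear_value i₀
    clear hL hL1 hL2
    induction L with
    | zero => exact ⟨1, one_pos, fun n hn => absurd hn (Nat.not_lt_zero n)⟩
    | succ L ih =>
      obtain ⟨d, hd, h⟩ := ih
      refine ⟨min d (δ L), lt_min hd (hδ L), fun n hn => ?_⟩
      rcases Nat.lt_succ_iff_lt_or_eq.1 hn with h1 | rfl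
      · exact (min_le_left _ _).trans (h n h1)
      · exact min_le_right _ _
  refine ⟨d, hd, fun y h hy hh => le_of_forall_pos_le_add fun e he => ?_⟩
  obtain ⟨i, hi⟩ := exists_lt_of_ciInf_lt
    (show ⨅ i, ψ i y < H y + min (e / 2) 1 from lt_add_of_pos_right _ (by positivity))
  have hi1 : ψ i y < H y + e / 2 := hi.trans_le (by linarith [min_le_left (e / 2) 1])
  have hi2 : ψ i y < C + 1 := by
    have h1 := (abs_le.1 (hC y hy)).2
    have h2 := hHψ i₀ y
    linarith [min_le_right (e / 2) 1]
  have hNL : N i < L := by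
    by_contra hge
    push Not at hge
    have hge' : (L : ℝ) ≤ N i := by exact_mod_cast hge
    have h1 : (N i : ℝ) < ‖x i‖ + 1 := Nat.ceil_lt_add_one (norm_nonneg _)
    have h2 : 1 ≤ ‖y - x i‖ := by
      have := norm_sub_norm_le (x i) y
      rw [norm_sub_rev] at this
      linarith
    have h3 := (hφ (N i) i (hN i)).2 (y - x i) h2
    have h4 : ψ i y = f i + inner ℝ (G i) (y - x i) + φ (N i) (y - x i) := rfl
    linarith
  have h1 := hδφ (N i) (y - x i) h ((norm_sub_le _ _).trans (add_le_add hy (hN i)))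
    (hh.trans (hdδ _ hNL))
  have h2 := hHψ i (y + h)
  have h3 := hHψ i (y - h)
  have e1 : y + h - x i = y - x i + h := by abel
  have e2 : y - h - x i = y - x i - h := by abel
  simp only [ψ, e1, e2, inner_add_right, inner_sub_right (G i) (y - x i) h] at h2 h3 hi1
  linarith

/-- If the slopes affinely span the space, then a convex jet is the trace of a `C¹` convex
function. -/
theorem exists_extension [Nonempty ι] (hJ : IsConvexJet x f G)
    (hspan : affineSpan ℝ (Set.range G) = ⊤) :
    ∃ F : V → ℝ, ConvexOn ℝ Set.univ F ∧ ContDiff ℝ 1 F ∧ (∀ i, F (x i) = f i) ∧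
      ∀ i, HasGradientAt F (G i) (x i) := by
  obtain ⟨H, hHS, hmH, hHx⟩ := hJ.exists_upperSmooth_above
  have hm := hJ.convexOn
  -- For g interior to the convex hull of the slopes, m - ⟨g, ·⟩ is coercive.
  obtain ⟨g, hg⟩ := interior_convexHull_nonempty_iff_affineSpan_eq_top.2 hspan
  set m := minimalExtension x f G with hmdef
  have hlin : ∀ p : V, ConvexOn ℝ Set.univ (fun y => (inner ℝ p y : ℝ)) := fun p =>
    (innerSL ℝ p).toLinearMap.convexOn convex_univ
  have hm' : ConvexOn ℝ Set.univ (fun y => m y + inner ℝ (-g) y) := hm.add (hlin (-g))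
  have hcoer : ∀ C : ℝ, ∃ R : ℝ, ∀ y, m y + inner ℝ (-g) y ≤ C → ‖y‖ ≤ R := by
    intro C
    by_contra hcon
    push Not at hcon
    choose y hyC hyR using fun k : ℕ => hcon (k + 1)
    have hypos : ∀ k, 0 < ‖y k‖ := fun k => lt_trans (by positivity) (hyR k)
    have hsph : ∀ k, ‖y k‖⁻¹ • y k ∈ Metric.sphere (0 : V) 1 := fun k => by
      rw [mem_sphere_zero_iff_norm, norm_smul, norm_inv, norm_norm,
        inv_mul_cancel₀ (hypos k).ne']
    obtain ⟨u, hu, s, hs, hlim⟩ := (isCompact_sphere (0 : V) 1).tendsto_subseq hsph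
    have hinv : Tendsto (fun k => ‖y (s k)‖⁻¹) atTop (𝓝 0) := by
      have : Tendsto (fun k => ‖y k‖) atTop atTop :=
        tendsto_atTop_mono (fun k => (by linarith [hyR k] : (k : ℝ) ≤ ‖y k‖))
          tendsto_natCast_atTop_atTop
      exact (this.comp hs.tendsto_atTop).inv_tendsto_atTop
    -- If coercivity fails, a limit direction u puts all slopes in the half-space ⟨v, u⟩ ≤ ⟨g, u⟩,
    -- impossible for interior g.
    have hhalf : Set.range G ⊆ {v : V | inner ℝ v u ≤ (inner ℝ g u : ℝ)} := by
      rintro _ ⟨i, rfl⟩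
      have hle : ∀ k, (inner ℝ (G i - g) (‖y (s k)‖⁻¹ • y (s k)) : ℝ)
          ≤ ‖y (s k)‖⁻¹ * (C - f i + inner ℝ (G i) (x i)) := by
        intro k
        rw [real_inner_smul_right]
        refine mul_le_mul_of_nonneg_left ?_ (by positivity)
        have h1 := hJ.plane_le i (y (s k))
        have h2 := hyC (s k)
        rw [inner_neg_left] at h2
        rw [inner_sub_right] at h1
        rw [inner_sub_left]
        linarith
      have h1 : Tendsto (fun k => (inner ℝ (G i - g) (‖y (s k)‖⁻¹ • y (s k)) : ℝ)) atTop
          (𝓝 (inner ℝ (G i - g) u)) := tendsto_const_nhds.inner hlim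
      have h2 : Tendsto (fun k => ‖y (s k)‖⁻¹ * (C - f i + inner ℝ (G i) (x i))) atTop (𝓝 0) := by
        simpa using hinv.mul_const (C - f i + inner ℝ (G i) (x i))
      have h3 := le_of_tendsto_of_tendsto' h1 h2 hle
      rw [inner_sub_left] at h3
      simp only [Set.mem_ofPred_eq]; linarith
    have hconvhalf : Convex ℝ {v : V | inner ℝ v u ≤ (inner ℝ g u : ℝ)} := by
      have := (hlin u).convex_le (inner ℝ g u)
      simpa [real_inner_comm] using this
    have hsub := convexHull_min hhalf hconvhalf
    have hnhds := mem_interior_iff_mem_nhds.1 hg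
    obtain ⟨r, hr, hball⟩ := Metric.mem_nhds_iff.1 hnhds
    have hun : ‖u‖ = 1 := by simpa using hu
    have hmem : g + (r / 2) • u ∈ Metric.ball g r := by
      rw [mem_ball_iff_norm, add_sub_cancel_left, norm_smul, hun, mul_one,
        Real.norm_of_nonneg (by positivity)]
      linarith
    have := hsub (hball hmem)
    simp only [Set.mem_ofPred_eq, inner_add_left, real_inner_smul_left,
      real_inner_self_eq_norm_sq, hun] at this
    linarith
  obtain ⟨F, hFc, hFS, hmF, hFH⟩ := (hHS.add (upperSmooth_inner (-g))).exists_convex_between hm'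
    (fun y => by linarith [hmH y]) hcoer
  have hKc : ConvexOn ℝ Set.univ (fun y => F y + inner ℝ g y) := hFc.add (hlin g)
  have hKS : UpperSmooth (fun y => F y + inner ℝ g y) := hFS.add (upperSmooth_inner g)
  have hmK : ∀ y, m y ≤ F y + inner ℝ g y := fun y => by
    have := hmF y; rw [inner_neg_left] at this; linarith
  have hKx : ∀ i, F (x i) + inner ℝ g (x i) = f i := fun i => by
    have h1 := hFH (x i)
    have h2 := hmK (x i)
    have h3 := hHx i
    rw [inner_neg_left] at h1
    rw [hmdef, hJ.minimalExtension_apply] at h2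
    linarith
  refine ⟨fun y => F y + inner ℝ g y, hKc, hKc.contDiff_of_upperSmooth hKS, hKx, fun i =>
    hKS.hasGradientAt fun h => ?_⟩
  have h1 := hJ.plane_le i (x i + h)
  rw [add_sub_cancel_left] at h1
  have h2 := hmK (x i + h)
  have h3 := hKx i
  linarith

end IsConvexJet

end ConvexJets

/-! ### Sequential hypotheses in uniform form. -/

section Reduction

variable {V : Type*} [NormedAddCommGroup V] [InnerProductSpace ℝ V] {ι : Type*}

/-- A failing sequence has ‖G‖ → ∞, because convexity at a fixed i₀ bounds the dual values below by
an affine function of ‖G‖; the sequential hypothesis then gives a contradiction. -/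
theorem exists_dual_growth [Nonempty ι] {x : ι → V} {f : ι → ℝ} {G : ι → V}
    (hC : ∀ i j, f j + inner ℝ (G j) (x i - x j) ≤ f i)
    (hEX : ∀ s : ℕ → ι, Tendsto (fun k => ‖G (s k)‖) atTop atTop →
      Tendsto (fun k => (inner ℝ (G (s k)) (x (s k)) - f (s k)) / ‖G (s k)‖) atTop atTop) (M : ℝ) :
    ∃ C : ℝ, ∀ i, M * ‖G i‖ ≤ inner ℝ (G i) (x i) - f i + C := by
  by_contra hcon
  push Not at hcon
  choose s hs using fun k : ℕ => hcon k
  let i₀ : ι := Classical.arbitrary ι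
  set A : ℝ := |M| + ‖x i₀‖ + 1 with hA
  have hA0 : 0 < A := by positivity
  have hbig : ∀ k : ℕ, ((k : ℝ) - |f i₀|) / A ≤ ‖G (s k)‖ := by
    intro k
    rw [div_le_iff₀ hA0]
    have h1 := hs k
    have h2 := hC i₀ (s k)
    rw [inner_sub_right] at h2
    have h3 := (abs_le.1 (abs_real_inner_le_norm (G (s k)) (x i₀))).1
    have h4 := le_abs_self (f i₀)
    have h5 := mul_le_mul_of_nonneg_right (le_abs_self M) (norm_nonneg (G (s k)))
    have h6 : ‖G (s k)‖ * A = |M| * ‖G (s k)‖ + ‖G (s k)‖ * ‖x i₀‖ + ‖G (s k)‖ := by rw [hA]; ring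
    have := norm_nonneg (G (s k))
    linarith
  have htend : Tendsto (fun k => ‖G (s k)‖) atTop atTop :=
    tendsto_atTop_mono hbig
      ((tendsto_atTop_add_const_right _ _ tendsto_natCast_atTop_atTop).atTop_div_const hA0)
  obtain ⟨k, hk1, hk2⟩ := ((hEX s htend).eventually_ge_atTop M |>.and
    (htend.eventually_gt_atTop 0)).exists
  rw [le_div_iff₀ hk2] at hk1
  have h1 := hs k
  have : (0 : ℝ) ≤ k := k.cast_nonneg
  linarith

theorem exists_slope_modulus {x : ι → V} {f : ι → ℝ} {G : ι → V} {T : V →L[ℝ] V}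
    (hC : ∀ i j, f j + inner ℝ (G j) (x i - x j) ≤ f i)
    (hCW : ∀ s t : ℕ → ι, Bornology.IsBounded (Set.range fun k => T (x (s k))) →
      Bornology.IsBounded (Set.range fun k => G (t k)) →
      Tendsto (fun k => f (s k) - f (t k) - inner ℝ (G (t k)) (x (s k) - x (t k))) atTop (𝓝 0) →
      Tendsto (fun k => ‖G (s k) - G (t k)‖) atTop (𝓝 0)) (R : ℝ) {ε : ℝ} (hε : 0 < ε) :
    ∃ δ > 0, ∀ i j, ‖T (x i)‖ ≤ R → ‖G j‖ ≤ R →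
      f i - f j - inner ℝ (G j) (x i - x j) < δ → ‖G i - G j‖ < ε := by
  by_contra hcon
  push Not at hcon
  choose s t hs ht hst hge using fun k : ℕ => hcon (1 / ((k : ℝ) + 1)) (by positivity)
  have hbdd : ∀ {y : ℕ → V}, (∀ k, ‖y k‖ ≤ R) → Bornology.IsBounded (Set.range y) := fun h =>
    isBounded_iff_forall_norm_le.2 ⟨R, by rintro _ ⟨k, rfl⟩; exact h k⟩
  have hlim := hCW s t (hbdd hs) (hbdd ht)
    (squeeze_zero (fun k => by linarith [hC (s k) (t k)]) (fun k => (hst k).le)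
      tendsto_one_div_add_atTop_nhds_zero_nat)
  obtain ⟨k, hk⟩ := (hlim.eventually_lt_const hε).exists
  exact absurd (hge k) (not_le.2 hk)

end Reduction

/-! ### The theorem, by reduction to Y. -/

theorem mainTheorem7 {n : ℕ} (E : Set (EuclideanSpace ℝ (Fin n)))
    (f : E → ℝ) (G : E → EuclideanSpace ℝ (Fin n))
    (hG : Continuous G)
    (hC : ∀ x y : E, f x ≥ f y + inner ℝ (G y) ((x : EuclideanSpace ℝ (Fin n)) - y))
    (hEX : ∀ x : ℕ → E,
      Tendsto (fun k => ‖G (x k)‖) atTop atTop →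
      Tendsto (fun k => (inner ℝ (G (x k)) (x k : EuclideanSpace ℝ (Fin n)) - f (x k))
        / ‖G (x k)‖) atTop atTop)
    (hCW : ∀ x z : ℕ → E,
      Bornology.IsBounded
        (Set.range fun k => (differenceSpan G).starProjection (x k : EuclideanSpace ℝ (Fin n))) →
      Bornology.IsBounded (Set.range fun k => G (z k)) →
      Tendsto (fun k => f (x k) - f (z k)
        - inner ℝ (G (z k)) ((x k : EuclideanSpace ℝ (Fin n)) - z k)) atTop (𝓝 0) →
      Tendsto (fun k => ‖G (x k) - G (z k)‖) atTop (𝓝 0)) :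
    ∃ F : EuclideanSpace ℝ (Fin n) → ℝ,
      ConvexOn ℝ Set.univ F ∧ ContDiff ℝ 1 F ∧
      (∀ x : E, F x = f x) ∧ (∀ x : E, HasGradientAt F (G x) (x : EuclideanSpace ℝ (Fin n))) := by
  rcases isEmpty_or_nonempty E with hE | ⟨⟨x₀⟩⟩
  · exact ⟨fun _ => 0, convexOn_const 0 convex_univ, contDiff_const, fun x => hE.elim x,
      fun x => hE.elim x⟩
  have : Nonempty E := ⟨x₀⟩
  set Y := differenceSpan G
  let P : EuclideanSpace ℝ (Fin n) →L[ℝ] Y := Y.orthogonalProjectionOnto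
  have hP : ∀ (v : Y) (y : EuclideanSpace ℝ (Fin n)),
      (inner ℝ v (P y) : ℝ) = inner ℝ (v : EuclideanSpace ℝ (Fin n)) y :=
    fun v y => Y.inner_orthogonalProjectionOnto_eq_of_mem_left v y
  let G' : E → Y := fun x => ⟨G x - G x₀, Submodule.subset_span ⟨x, x₀, rfl⟩⟩
  let f' : E → ℝ := fun x => f x - inner ℝ (G x₀) (x : EuclideanSpace ℝ (Fin n))
  let x' : E → Y := fun x => P x
  have hG'n : ∀ i, ‖G' i‖ = ‖G i - G x₀‖ := fun i => rfl
  have hinner : ∀ i (y : EuclideanSpace ℝ (Fin n)),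
      (inner ℝ (G' i) (P y) : ℝ) = inner ℝ (G i) y - inner ℝ (G x₀) y := fun i y => by
    rw [hP]; exact inner_sub_left _ _ _
  have hJ : IsConvexJet x' f' G' := by
    refine ⟨fun i j => ?_, fun M => ?_, fun R ε hε => ?_⟩
    · have h1 := hC i j
      simp only [x', f', inner_sub_right, hinner] at h1 ⊢
      linarith
    -- The dual value ⟨G i, x i⟩ - f i is unchanged by the normalisation; only the norm of the slope
    -- shifts.
    · obtain ⟨C, hCM⟩ := exists_dual_growth hC hEX |M|
      refine ⟨C + |M| * ‖G x₀‖, fun i => ?_⟩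
      have h1 := hCM i
      have h2 : M * ‖G' i‖ ≤ |M| * (‖G i‖ + ‖G x₀‖) := by
        rw [hG'n]
        exact mul_le_mul (le_abs_self M) (norm_sub_le _ _) (norm_nonneg _) (abs_nonneg M)
      simp only [x', f', hinner]
      linarith
    · obtain ⟨δ, hδ, H⟩ := exists_slope_modulus hC hCW (R + ‖G x₀‖) hε
      refine ⟨δ, hδ, fun i j hi hj hij => ?_⟩
      have h1 : ‖Y.starProjection (i : EuclideanSpace ℝ (Fin n))‖ ≤ R := hi
      have h2 : ‖G j‖ ≤ R + ‖G x₀‖ := by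
        rw [hG'n] at hj
        have := norm_sub_norm_le (G j) (G x₀)
        linarith
      have h3 := H i j (by linarith [norm_nonneg (G x₀)]) h2 (by
        simp only [x', f', inner_sub_right, hinner] at hij
        simp only [inner_sub_right]
        linarith)
      have h4 : G' i - G' j = ⟨G i - G j, Submodule.subset_span ⟨i, j, rfl⟩⟩ :=
        Subtype.ext (by simp [G'])
      rw [h4]
      exact h3
  have hspan : affineSpan ℝ (Set.range G') = ⊤ := by
    rw [AffineSubspace.affineSpan_eq_top_iff_vectorSpan_eq_top_of_nonempty ℝ _ _
      (Set.range_nonempty G'), vectorSpan_def, eq_top_iff]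
    refine (Submodule.span_span_coe_preimage (R := ℝ)
      (s := {v | ∃ x y : E, v = G x - G y})).ge.trans (Submodule.span_mono ?_)
    rintro v ⟨i, j, hv⟩
    exact Set.mem_vsub.2 ⟨G' i, ⟨i, rfl⟩, G' j, ⟨j, rfl⟩, Subtype.ext
      ((sub_sub_sub_cancel_right (G i) (G j) (G x₀)).trans hv.symm)⟩
  obtain ⟨F, hFc, hFd, hFx, hFg⟩ := hJ.exists_extension hspan
  -- The adjoint of P is the inclusion of Y, so the gradient at i is G' i + G x₀ = G i.
  refine ⟨fun y => F (P y) + inner ℝ (G x₀) y, ?_, ?_, fun i => ?_, fun i => ?_⟩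
  · have h1 : ConvexOn ℝ Set.univ (fun y => F (P y)) :=
      hFc.comp_linearMap P.toLinearMap
    exact h1.add ((innerSL ℝ (G x₀)).toLinearMap.convexOn convex_univ)
  · exact (hFd.comp P.contDiff).add (innerSL ℝ (G x₀)).contDiff
  · have := hFx i
    simp only [x', f'] at this
    linarith
  · have h1 : HasFDerivAt F (InnerProductSpace.toDual ℝ Y (G' i)) (P i) := (hFg i).hasFDerivAt
    have h2 := (h1.comp (i : EuclideanSpace ℝ (Fin n)) P.hasFDerivAt).add
      (innerSL ℝ (G x₀)).hasFDerivAt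
    rw [hasGradientAt_iff_hasFDerivAt]
    refine h2.congr_fderiv (ContinuousLinearMap.ext fun y => ?_)
    have h3 := hinner i y
    simp only [add_apply, ContinuousLinearMap.comp_apply,
      InnerProductSpace.toDual_apply_apply, innerSL_apply_apply]
    linarith
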